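/- Let $(r_i)_{i\ge 1}$ be a sequence of integers, not all equal to $0$, and let $t\ge 1$ be an integer with $r_{i+t}=r_i$ for all $i\ge 1$. For $n\ge 1$ let $L_n$ be the least common multiple of all $i\in\{1,\dots,n\}$ with $r_i\ne 0$, and let $X_n=L_n\sum_{i=1}^n \frac{r_i}{i}$, which is an integer. Put $r=\max_i|r_i|$ and $m=\max(r,t)+1$, let $z$ be the number of primes strictly smaller than $m$, and let $i_1$ be the smallest positive integer with $r_{i_1}\neq 0$. Let $\tilde m$ be the smallest integer larger than $42m^{3z+7}$ such that $\tilde m\equiv i_1 \pmod t$ and such that $\tilde m$ has a prime divisor larger than $m^{3z+5}$. Let $J_1=[\tilde m-m^{3z+5},\tilde m)$ and $J_2=[\tilde m,\tilde m+m^{3z+5})$. Set $I_0=J_1$ if $|X_n|>m^2n^z$ holds for all integers $n\in J_1$, and $I_0=J_2$ otherwise. Then there exists an integer $n\in I_0$ such that $X_n$ is non-zero and divisible by a prime $p\ge m$. -/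

import Mathlib

namespace PeriodicHarmonic

/-- `L_n`: the least common multiple of all `i ∈ {1, …, n}` with `r i ≠ 0`. -/
def L (r : ℕ → ℤ) (n : ℕ) : ℕ :=
  ((Finset.Icc 1 n).filter (fun i => r i ≠ 0)).lcm id

/-- `X_n = L_n * ∑_{i=1}^n r_i / i`, as an integer. Every `i` with `r i ≠ 0` divides `L_n`, so the
integer divisions that matter are exact; see `X_cast`. -/
def X (r : ℕ → ℤ) (n : ℕ) : ℤ :=
  ∑ i ∈ Finset.Icc 1 n, r i * ((L r n / i : ℕ) : ℤ)

theorem X_cast (r : ℕ → ℤ) (n : ℕ) :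
    (X r n : ℚ) = (L r n : ℚ) * ∑ i ∈ Finset.Icc 1 n, (r i : ℚ) / (i : ℚ) := by
  unfold X
  rw [Int.cast_sum, Finset.mul_sum]
  refine Finset.sum_congr rfl fun i hi => ?_
  by_cases h : r i = 0
  · simp [h]
  · have hd : i ∣ L r n := by
      have hm : i ∈ (Finset.Icc 1 n).filter (fun i => r i ≠ 0) := Finset.mem_filter.mpr ⟨hi, h⟩
      exact Finset.dvd_lcm (f := id) hm
    have hi0 : (i : ℚ) ≠ 0 := by
      have := (Finset.mem_Icc.mp hi).1
      positivity
    rw [Int.cast_mul, Int.cast_natCast, Nat.cast_div hd hi0]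
    ring

/-- `max_i |r_i|` over all positive `i` (the sequences considered are periodic, so bounded). -/
noncomputable def maxAbs (r : ℕ → ℤ) : ℕ :=
  sSup {k : ℕ | ∃ i : ℕ, 1 ≤ i ∧ k = (r i).natAbs}

theorem maxAbs_isGreatest (r : ℕ → ℤ) (t : ℕ) (ht : 1 ≤ t)
    (hper : ∀ i : ℕ, 1 ≤ i → r (i + t) = r i) :
    IsGreatest {k : ℕ | ∃ i : ℕ, 1 ≤ i ∧ k = (r i).natAbs} (maxAbs r) := by
  have hb : ∀ i : ℕ, 1 ≤ i → (r i).natAbs ≤ (Finset.Icc 1 t).sup fun j => (r j).natAbs := by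
    intro i
    induction i using Nat.strong_induction_on with
    | _ i ih =>
      intro hi
      by_cases h : i ≤ t
      · exact Finset.le_sup (f := fun j => (r j).natAbs) (Finset.mem_Icc.mpr ⟨hi, h⟩)
      · have h1 := hper (i - t) (by omega)
        rw [Nat.sub_add_cancel (by omega)] at h1
        rw [h1]
        exact ih (i - t) (by omega) (by omega)
  have hbdd : BddAbove {k : ℕ | ∃ i : ℕ, 1 ≤ i ∧ k = (r i).natAbs} :=
    ⟨_, by rintro k ⟨i, hi, rfl⟩; exact hb i hi⟩
  exact ⟨Nat.sSup_mem ⟨_, 1, le_refl 1, rfl⟩ hbdd, fun k hk => le_csSup hbdd hk⟩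

/-- `i_1`: the smallest positive integer with `r i ≠ 0`. -/
noncomputable def firstIndex (r : ℕ → ℤ) : ℕ :=
  sInf {i : ℕ | 1 ≤ i ∧ r i ≠ 0}

/-- `m = max (r, t) + 1`, where `r = max_i |r_i|`. -/
noncomputable def bound (r : ℕ → ℤ) (t : ℕ) : ℕ :=
  max (maxAbs r) t + 1

/-- `z`: the number of primes strictly below `m`. -/
noncomputable def numPrimes (r : ℕ → ℤ) (t : ℕ) : ℕ :=
  Nat.primeCounting' (bound r t)

/-- The common length `m ^ (3 z + 5)` of the intervals `J_1` and `J_2`. -/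
noncomputable def len (r : ℕ → ℤ) (t : ℕ) : ℕ :=
  bound r t ^ (3 * numPrimes r t + 5)

/-- `m̃`: the smallest integer larger than `42 m ^ (3 z + 7)` that is congruent to `i_1` modulo `t`
and has a prime divisor larger than `m ^ (3 z + 5)`. -/
noncomputable def center (r : ℕ → ℤ) (t : ℕ) : ℕ :=
  sInf {x : ℕ | 42 * bound r t ^ (3 * numPrimes r t + 7) < x ∧ x ≡ firstIndex r [MOD t] ∧
    ∃ q : ℕ, q.Prime ∧ len r t < q ∧ q ∣ x}

/-- An integer as in the definition of `center` exists. -/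
theorem center_nonempty (r : ℕ → ℤ) (t : ℕ) (ht : 1 ≤ t) :
    {x : ℕ | 42 * bound r t ^ (3 * numPrimes r t + 7) < x ∧ x ≡ firstIndex r [MOD t] ∧
      ∃ q : ℕ, q.Prime ∧ len r t < q ∧ q ∣ x}.Nonempty := by
  obtain ⟨q, hq, hp⟩ := Nat.exists_infinite_primes
    (42 * bound r t ^ (3 * numPrimes r t + 7) + len r t + t + 1)
  have hcop : Nat.Coprime t q :=
    ((Nat.Prime.coprime_iff_not_dvd hp).mpr fun h => by
      have := Nat.le_of_dvd ht h
      omega).symm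
  obtain ⟨x, hx1, hx2⟩ := Nat.chineseRemainder hcop (firstIndex r) 0
  refine ⟨x + t * q, ?_, ?_, q, hp, by omega, ?_⟩
  · have : q ≤ t * q := Nat.le_mul_of_pos_left q ht
    omega
  · calc x + t * q ≡ x + 0 [MOD t] :=
          Nat.ModEq.add_left x ((Nat.modEq_zero_iff_dvd).mpr (Dvd.intro q rfl))
      _ ≡ firstIndex r [MOD t] := by simpa using hx1
  · exact dvd_add ((Nat.modEq_zero_iff_dvd).mp hx2) (Dvd.intro_left t rfl)

/-- `J_1 = [m̃ - m ^ (3 z + 5), m̃)`. The subtraction is not truncated, as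
`m̃ > 42 m ^ (3 z + 7)`. -/
noncomputable def J₁ (r : ℕ → ℤ) (t : ℕ) : Finset ℕ :=
  Finset.Ico (center r t - len r t) (center r t)

/-- `J_2 = [m̃, m̃ + m ^ (3 z + 5))`. -/
noncomputable def J₂ (r : ℕ → ℤ) (t : ℕ) : Finset ℕ :=
  Finset.Ico (center r t) (center r t + len r t)

/-- `I_0 = J_1` if `|X_n| > m ^ 2 * n ^ z` for all `n ∈ J_1`, and `I_0 = J_2` otherwise. -/
noncomputable def I₀ (r : ℕ → ℤ) (t : ℕ) : Finset ℕ :=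
  if ∀ n ∈ J₁ r t, (bound r t : ℤ) ^ 2 * (n : ℤ) ^ numPrimes r t < |X r n| then J₁ r t else J₂ r t

end PeriodicHarmonic

namespace PeriodicHarmonic

open Finset

/-! Every interval `[a, a + m ^ 5)` with `a ≥ 5 m ^ 10` contains a suitable `n`
(`exists_prime_dvd_X`); both `J₁` and `J₂` contain such an interval, so the case split in `I₀` is
harmless. Suppose each nonzero `X_n` there has only prime factors below `m`. With `H = (2a) ^ (m ^
5)`, either `|X_n| ≤ H ^ z`, or some prime `p < m` has its exact power in `X_n` above `H`. This
colours the interval with `z + 1` colours. Equal colours force equal partial sums. If they differed,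
a common prime power would be bounded by the numerator of the difference times a prime power in `L`
(`prime_pow_le_of_dvd_X`); two small values would contradict the exponential growth of `L`
(`partialSum_eq_of_X_le`, `pow_lt_L`). By pigeonhole, partial sums then coincide often along a
progression of step `t`. By periodicity, coincidences at a fixed distance are roots of one nonzero
polynomial, hence too few (`card_partialSum_eq_lt`, `windows_le`). -/

/-! ### Size and prime powers of `L_n`. -/

theorem prod_progression_dvd (d N : ℤ) (k : ℕ) :
    ∀ u : ℤ, (∀ j ≤ k, u + j * d ∣ N) →
      ∏ j ∈ range (k + 1), (u + j * d) ∣ N * k.factorial * d ^ k := by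
  induction k with
  | zero => intro u h; simpa using h 0 le_rfl
  | succ k ih =>
    intro u h
    have h1 := ih u fun j hj => h j (by omega)
    have h2 := ih (u + d) fun j hj => by
      have := h (j + 1) (by omega)
      push_cast at this
      rwa [show u + d + j * d = u + (j + 1) * d by ring]
    have e1 : ∏ j ∈ range (k + 1 + 1), (u + (j : ℤ) * d)
        = (∏ j ∈ range (k + 1), (u + (j : ℤ) * d)) * (u + (k + 1) * d) := by
      rw [prod_range_succ]; push_cast; rfl
    have e2 : ∏ j ∈ range (k + 1 + 1), (u + (j : ℤ) * d)
        = (∏ j ∈ range (k + 1), (u + d + (j : ℤ) * d)) * u := by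
      rw [prod_range_succ']
      congr 1
      · refine prod_congr rfl fun j _ => ?_
        push_cast; ring
      · simp
    -- The two products omit the last and the first factor; the restored factors differ by `(k + 1)
    -- * d`, which supplies the new part of `(k + 1)! * d ^ (k + 1)`.
    have d1 := mul_dvd_mul_right h1 (u + (k + 1) * d)
    have d2 := mul_dvd_mul_right h2 u
    rw [← e1] at d1
    rw [← e2] at d2
    have := dvd_sub d1 d2
    rw [Nat.factorial_succ, pow_succ]
    push_cast
    exact this.trans (dvd_of_eq (by ring))

/-- An integer divisible by a long stretch of a primitive arithmetic progression is large. -/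
theorem four_pow_le_of_progression_dvd {u d N s : ℕ} (hu : 1 ≤ u) (hd : 1 ≤ d)
    (hN : 0 < N) (hc : Nat.Coprime u d) (h : ∀ j ≤ 2 * s, u + j * d ∣ N) : 4 ^ s ≤ N := by
  -- Only the upper half is used: its factors are at least `s + 1 + j`, which yields a central
  -- binomial coefficient.
  have h1 := prod_progression_dvd (d : ℤ) (N : ℤ) s (u + s * d : ℤ) fun j hj => by
    have := h (s + j) (by omega)
    have : ((u + (s + j) * d : ℕ) : ℤ) ∣ (N : ℤ) := by exact_mod_cast this
    push_cast at this
    rwa [show (u : ℤ) + s * d + j * d = u + (s + j) * d by ring]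
  have h2 : ∏ j ∈ range (s + 1), (u + s * d + j * d) ∣ N * s.factorial * d ^ s := by
    exact_mod_cast h1
  have h3 : ∏ j ∈ range (s + 1), (u + s * d + j * d) ∣ N * s.factorial := by
    refine Nat.Coprime.dvd_of_dvd_mul_right ?_ h2
    refine Nat.Coprime.pow_right _ (Nat.Coprime.prod_left fun j _ => ?_)
    rw [add_assoc, ← add_mul]
    simpa using hc
  have h4 : (s + 1).ascFactorial (s + 1) ≤ N * s.factorial := by
    refine le_trans ?_ (Nat.le_of_dvd (Nat.mul_pos hN s.factorial_pos) h3)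
    rw [Nat.ascFactorial_eq_prod_range]
    refine prod_le_prod' fun j _ => ?_
    have := Nat.le_mul_of_pos_right s hd
    have := Nat.le_mul_of_pos_right j hd
    omega
  have h5 : s.factorial * (s + 1).ascFactorial (s + 1) = (2 * s + 1).factorial := by
    rw [Nat.factorial_mul_ascFactorial]; congr 1; omega
  have h6 : (2 * s + 1).factorial
      = (2 * s + 1) * Nat.centralBinom s * s.factorial * s.factorial := by
    rw [Nat.factorial_succ, Nat.centralBinom_eq_two_mul_choose]
    have := Nat.choose_mul_factorial_mul_factorial (n := 2 * s) (k := s) (by omega)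
    rw [show 2 * s - s = s by omega] at this
    rw [← this]; ring
  have h7 : (2 * s + 1) * Nat.centralBinom s ≤ N := by
    have h8 : (2 * s + 1) * Nat.centralBinom s * (s.factorial * s.factorial)
        ≤ N * (s.factorial * s.factorial) := by
      calc _ = s.factorial * (s + 1).ascFactorial (s + 1) := by rw [h5, h6]; ring
        _ ≤ s.factorial * (N * s.factorial) := Nat.mul_le_mul_left _ h4
        _ = _ := by ring
    exact Nat.le_of_mul_le_mul_right h8 (by positivity)
  refine le_trans ?_ h7
  rcases Nat.eq_zero_or_pos s with rfl | hs
  · simp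
  · have := Nat.four_pow_le_two_mul_self_mul_centralBinom s hs
    nlinarith [Nat.centralBinom_pos s]

theorem apply_add_mul {r : ℕ → ℤ} {t : ℕ} (hper : ∀ i : ℕ, 1 ≤ i → r (i + t) = r i)
    {i : ℕ} (hi : 1 ≤ i) (q : ℕ) : r (i + q * t) = r i := by
  induction q with
  | zero => simp
  | succ q ih => rw [Nat.succ_mul, ← add_assoc, hper _ (by omega), ih]

/-- Every window of length `t` contains an index at which `r` does not vanish. -/
theorem exists_ne_zero_window {r : ℕ → ℤ} {t : ℕ} (ht : 1 ≤ t)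
    (hper : ∀ i : ℕ, 1 ≤ i → r (i + t) = r i) (hne : ∃ i : ℕ, 1 ≤ i ∧ r i ≠ 0) (a : ℕ) :
    ∃ j, 1 ≤ j ∧ j ≤ t ∧ r (a + j) ≠ 0 := by
  induction a with
  | zero =>
    obtain ⟨i, hi, hri⟩ := hne
    refine ⟨(i - 1) % t + 1, by omega, Nat.mod_lt _ ht, ?_⟩
    have h := apply_add_mul hper (i := (i - 1) % t + 1) (by omega) ((i - 1) / t)
    have e := Nat.mod_add_div (i - 1) t
    rw [mul_comm] at e
    rw [show (i - 1) % t + 1 + (i - 1) / t * t = i by omega] at h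
    rwa [zero_add, ← h]
  | succ a ih =>
    obtain ⟨j, h1, h2, h3⟩ := ih
    rcases Nat.eq_or_lt_of_le h1 with rfl | h
    · refine ⟨t, ht, le_rfl, ?_⟩
      rwa [hper _ (by omega)]
    · exact ⟨j - 1, by omega, by omega, by rwa [show a + 1 + (j - 1) = a + j by omega]⟩

theorem L_pos (r : ℕ → ℤ) (n : ℕ) : 0 < L r n := by
  refine Nat.pos_of_ne_zero fun h => ?_
  rw [L, Finset.lcm_eq_zero_iff] at h
  simp at h

theorem L_dvd_L (r : ℕ → ℤ) {a b : ℕ} (h : a ≤ b) : L r a ∣ L r b :=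
  Finset.lcm_mono (filter_subset_filter _ (Icc_subset_Icc_right h))

/-- One nonvanishing index `i ≤ t` gives a whole progression `i + j * t` of divisors of `L_n`;
dividing out `gcd(i, t)` makes it primitive. -/
theorem four_pow_le_L {r : ℕ → ℤ} {t : ℕ} (ht : 1 ≤ t)
    (hper : ∀ i : ℕ, 1 ≤ i → r (i + t) = r i) (hne : ∃ i : ℕ, 1 ≤ i ∧ r i ≠ 0) {n s : ℕ}
    (hs : (2 * s + 1) * t ≤ n) : 4 ^ s ≤ L r n := by
  obtain ⟨i, h1, h2, h3⟩ := exists_ne_zero_window ht hper hne 0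
  rw [zero_add] at h3
  obtain ⟨g, u, d, hg, hc, rfl, rfl⟩ := Nat.exists_coprime' (m := i) (n := t)
    (Nat.gcd_pos_of_pos_left _ h1)
  refine four_pow_le_of_progression_dvd (u := u) (d := d) (Nat.pos_of_mul_pos_right h1)
    (Nat.pos_of_mul_pos_right ht) (L_pos r n) hc fun j hj => ?_
  refine dvd_trans (Dvd.intro g rfl) (Finset.dvd_lcm (f := id) (mem_filter.mpr ⟨mem_Icc.mpr ?_, ?_⟩))
  · constructor
    · nlinarith
    · have := Nat.mul_le_mul_right (d * g) hj
      nlinarith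
  · have := apply_add_mul hper h1 j
    rwa [show (u + j * d) * g = u * g + j * (d * g) by ring, this]

/-- A prime power dividing an lcm divides one of its members. -/
theorem prime_pow_dvd_L {r : ℕ → ℤ} {n p f : ℕ} (hn : 1 ≤ n) (hp : p.Prime) (h : p ^ f ∣ L r n) :
    p ^ f ≤ n := by
  have key : ∀ s : Finset ℕ, (∀ i ∈ s, 1 ≤ i ∧ i ≤ n) → p ^ f ∣ s.lcm id → p ^ f ≤ n := by
    intro s
    induction s using Finset.induction_on with
    | empty => intro _ h; rw [lcm_empty] at h; rwa [Nat.dvd_one.1 h]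
    | insert a s ha ih =>
      intro hs h
      rw [Finset.lcm_insert] at h
      have h0 : s.lcm id ≠ 0 := fun h => by
        obtain ⟨i, hi, hi0⟩ := Finset.lcm_eq_zero_iff.1 h
        have := (hs i (mem_insert_of_mem hi)).1
        simp only [id] at hi0
        omega
      have ha0 : a ≠ 0 := by have := (hs a (mem_insert_self _ _)).1; omega
      have h' : p ^ f ∣ a ∨ p ^ f ∣ s.lcm id := by
        change p ^ f ∣ Nat.lcm a (s.lcm id) at h
        rw [hp.pow_dvd_iff_le_factorization (Nat.lcm_ne_zero ha0 h0),
          Nat.factorization_lcm ha0 h0] at h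
        rw [hp.pow_dvd_iff_le_factorization ha0, hp.pow_dvd_iff_le_factorization h0]
        simpa using h
      rcases h' with h | h
      · have := hs a (mem_insert_self _ _)
        exact (Nat.le_of_dvd this.1 h).trans this.2
      · exact ih (fun i hi => hs i (mem_insert_of_mem hi)) h
  exact key _ (fun i hi => mem_Icc.1 (mem_filter.1 hi).1) h

/-! ### Differences of partial sums and their numerators. -/

/-- The partial sum `∑_{i ≤ n} r_i / i`. -/
def partialSum (r : ℕ → ℤ) (n : ℕ) : ℚ := ∑ i ∈ Icc 1 n, (r i : ℚ) / (i : ℚ)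

/-- The numerator of `∑_{j ≤ D} c_j / (x + j)` over the common denominator `∏_{j ≤ D} (x + j)`. -/
noncomputable def numerator (c : ℕ → ℤ) (D : ℕ) : Polynomial ℤ :=
  ∑ j ∈ Icc 1 D, Polynomial.C (c j) * ∏ i ∈ (Icc 1 D).erase j, (Polynomial.X + Polynomial.C (i : ℤ))

theorem eval_numerator (c : ℕ → ℤ) (D : ℕ) (x : ℤ) :
    (numerator c D).eval x = ∑ j ∈ Icc 1 D, c j * ∏ i ∈ (Icc 1 D).erase j, (x + i) := by
  simp [numerator, Polynomial.eval_finsetSum, Polynomial.eval_prod]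

theorem natDegree_numerator_le (c : ℕ → ℤ) (D : ℕ) : (numerator c D).natDegree ≤ D - 1 := by
  refine Polynomial.natDegree_sum_le_of_forall_le _ _ fun j hj => ?_
  refine (Polynomial.natDegree_C_mul_le _ _).trans ((Polynomial.natDegree_prod_le _ _).trans ?_)
  simp only [Polynomial.natDegree_X_add_C, sum_const, smul_eq_mul, mul_one]
  rw [card_erase_of_mem hj, Nat.card_Icc]
  omega

theorem numerator_ne_zero {c : ℕ → ℤ} {D j : ℕ} (hj : j ∈ Icc 1 D) (hc : c j ≠ 0) :
    numerator c D ≠ 0 := by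
  intro h
  -- At `-j` only the `j`-th summand survives.
  have h1 := eval_numerator c D (-j)
  rw [h, Polynomial.eval_zero, sum_eq_single_of_mem j hj] at h1
  · have h2 : ∏ i ∈ (Icc 1 D).erase j, (-(j : ℤ) + i) ≠ 0 := by
      refine prod_ne_zero_iff.2 fun i hi => ?_
      have := (mem_erase.1 hi).1
      omega
    exact mul_ne_zero hc h2 h1.symm
  · intro k _ hk
    rw [prod_eq_zero (mem_erase.2 ⟨hk.symm, hj⟩) (by ring), mul_zero]

theorem partialSum_add_sub (r : ℕ → ℤ) (a D : ℕ) :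
    (partialSum r (a + D) - partialSum r a) * ∏ j ∈ Icc 1 D, ((a : ℚ) + j)
      = (numerator (fun j => r (a + j)) D).eval (a : ℤ) := by
  have h1 : partialSum r (a + D) - partialSum r a
      = ∑ j ∈ Icc 1 D, (r (a + j) : ℚ) / ((a : ℚ) + j) := by
    induction D with
    | zero => simp
    | succ D ih =>
      rw [sum_Icc_succ_top (by omega), ← ih, partialSum, ← add_assoc,
        sum_Icc_succ_top (by omega), ← partialSum]
      push_cast
      ring
  rw [h1, eval_numerator, sum_mul]
  push_cast
  refine sum_congr rfl fun j hj => ?_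
  have : (a : ℚ) + j ≠ 0 := by
    have := (mem_Icc.1 hj).1
    positivity
  rw [← mul_prod_erase _ _ hj]
  field_simp

theorem natAbs_eval_numerator_le {c : ℕ → ℤ} {D a R B : ℕ} (hR : ∀ j ∈ Icc 1 D, (c j).natAbs ≤ R)
    (hB : a + D ≤ B) (hDR : D * R ≤ B) : ((numerator c D).eval (a : ℤ)).natAbs ≤ B ^ D := by
  rcases Nat.eq_zero_or_pos D with rfl | hD
  · simp [eval_numerator]
  rw [eval_numerator]
  calc _ ≤ ∑ j ∈ Icc 1 D, (c j * ∏ i ∈ (Icc 1 D).erase j, ((a : ℤ) + i)).natAbs :=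
        Int.natAbs_sum_le _ _
    _ ≤ ∑ j ∈ Icc 1 D, R * B ^ (D - 1) := by
        refine sum_le_sum fun j hj => ?_
        rw [Int.natAbs_mul]
        refine Nat.mul_le_mul (hR j hj) ?_
        have e : ∏ i ∈ (Icc 1 D).erase j, ((a : ℤ) + i)
            = ((∏ i ∈ (Icc 1 D).erase j, (a + i) : ℕ) : ℤ) := by push_cast; rfl
        rw [e, Int.natAbs_natCast]
        refine (prod_le_pow_card _ _ B fun i hi => ?_).trans_eq ?_
        · have := (mem_Icc.1 (mem_erase.1 hi).2).2
          omega
        · rw [card_erase_of_mem hj, Nat.card_Icc]; rfl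
    _ = D * R * B ^ (D - 1) := by simp; ring
    _ ≤ B * B ^ (D - 1) := Nat.mul_le_mul_right _ hDR
    _ = B ^ D := by rw [← pow_succ', Nat.sub_add_cancel hD]

/-- The identity `(S_{a+D} - S_a) L_{a+D} = X_{a+D} - (L_{a+D} / L_a) X_a` without denominators. -/
theorem exists_prod_mul_X_sub (r : ℕ → ℤ) (a D : ℕ) :
    ∃ c : ℕ, L r (a + D) = L r a * c ∧
      ((∏ j ∈ Icc 1 D, (a + j) : ℕ) : ℤ) * (X r (a + D) - c * X r a)
        = (numerator (fun j => r (a + j)) D).eval (a : ℤ) * L r (a + D) := by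
  obtain ⟨c, hc⟩ := L_dvd_L r (Nat.le_add_right a D)
  refine ⟨c, hc, ?_⟩
  have h := partialSum_add_sub r a D
  have h1 := X_cast r a
  have h2 := X_cast r (a + D)
  rw [← partialSum] at h1 h2
  have hc' : (L r (a + D) : ℚ) = L r a * c := by exact_mod_cast hc
  have : (((∏ j ∈ Icc 1 D, (a + j) : ℕ) : ℤ) * (X r (a + D) - c * X r a) : ℚ)
      = (numerator (fun j => r (a + j)) D).eval (a : ℤ) * L r (a + D) := by
    rw [← h, h1, h2, hc']
    push_cast
    ring
  exact_mod_cast this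

theorem eval_numerator_eq_zero_iff (r : ℕ → ℤ) (a D : ℕ) :
    (numerator (fun j => r (a + j)) D).eval (a : ℤ) = 0 ↔
      partialSum r (a + D) = partialSum r a := by
  have h := partialSum_add_sub r a D
  have h0 : ∏ j ∈ Icc 1 D, ((a : ℚ) + j) ≠ 0 := prod_ne_zero_iff.2 fun j hj => by
    have := (mem_Icc.1 hj).1
    positivity
  constructor
  · intro h1
    rw [h1, Int.cast_zero, mul_eq_zero, or_iff_left h0, sub_eq_zero] at h
    exact h
  · intro h1
    rw [h1, sub_self, zero_mul] at h
    exact_mod_cast h.symm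

/-- A prime power dividing `X_a` and `X_{a+D}` is small unless the partial sums agree. -/
theorem prime_pow_le_of_dvd_X {r : ℕ → ℤ} {a D p e R B : ℕ} (hp : p.Prime) (ha : 1 ≤ a)
    (hR : ∀ i, 1 ≤ i → (r i).natAbs ≤ R) (hB : a + D ≤ B) (hDR : D * R ≤ B)
    (hne : partialSum r (a + D) ≠ partialSum r a)
    (h1 : (p : ℤ) ^ e ∣ X r a) (h2 : (p : ℤ) ^ e ∣ X r (a + D)) : p ^ e ≤ B ^ (D + 1) := by
  obtain ⟨c, hc, h⟩ := exists_prod_mul_X_sub r a D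
  have h3 : (p : ℤ) ^ e ∣ (numerator (fun j => r (a + j)) D).eval (a : ℤ) * L r (a + D) := by
    rw [← h]
    exact ((h2.sub (h1.mul_left _)).mul_left _)
  have h4 : p ^ e ∣ ((numerator (fun j => r (a + j)) D).eval (a : ℤ)).natAbs * L r (a + D) := by
    have := Int.natAbs_dvd_natAbs.2 h3
    rwa [Int.natAbs_mul, Int.natAbs_natCast, Int.natAbs_pow, Int.natAbs_natCast] at this
  -- Split `p ^ e`: the part in the numerator is at most `B ^ D`, the part in `L` at most `B`.
  obtain ⟨y, z, hy, hz, hyz⟩ := (Nat.dvd_mul).1 h4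
  obtain ⟨f, _, rfl⟩ := (Nat.dvd_prime_pow hp).1 (hyz ▸ Dvd.intro_left y rfl : z ∣ p ^ e)
  rw [← hyz, pow_succ]
  refine Nat.mul_le_mul ?_ ((prime_pow_dvd_L (by omega) hp hz).trans hB)
  refine (Nat.le_of_dvd (Int.natAbs_pos.2 ?_) hy).trans
    (natAbs_eval_numerator_le (fun j hj => hR _ (by omega)) hB hDR)
  rwa [Ne, eval_numerator_eq_zero_iff]

/-- If `X_a` and `X_{a+D}` are both small compared to `L_a`, then the partial sums agree. -/
theorem partialSum_eq_of_X_le {r : ℕ → ℤ} {a D B Y : ℕ} (hB : a + D ≤ B)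
    (h1 : (X r a).natAbs ≤ Y) (h2 : (X r (a + D)).natAbs ≤ Y) (hL : 2 * (B ^ D * Y) < L r a) :
    partialSum r (a + D) = partialSum r a := by
  obtain ⟨c, hc, h⟩ := exists_prod_mul_X_sub r a D
  by_contra hne
  rw [← eval_numerator_eq_zero_iff] at hne
  have hc1 : 1 ≤ c := Nat.pos_of_ne_zero fun h0 => by
    have := L_pos r (a + D)
    rw [hc, h0] at this
    simp at this
  -- A nonzero integer numerator has absolute value at least 1.
  have h3 : L r (a + D) ≤ (∏ j ∈ Icc 1 D, (a + j)) * (X r (a + D) - c * X r a).natAbs := by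
    have := congrArg Int.natAbs h
    rw [Int.natAbs_mul, Int.natAbs_mul, Int.natAbs_natCast, Int.natAbs_natCast] at this
    rw [this]
    exact Nat.le_mul_of_pos_left _ (Int.natAbs_pos.2 hne)
  have h4 : (X r (a + D) - c * X r a).natAbs ≤ c * (2 * Y) := by
    have := Int.natAbs_sub_le (X r (a + D)) (c * X r a)
    rw [Int.natAbs_mul, Int.natAbs_natCast] at this
    nlinarith
  have h5 : ∏ j ∈ Icc 1 D, (a + j) ≤ B ^ D := by
    refine (prod_le_pow_card _ _ B fun i hi => ?_).trans_eq (by simp)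
    have := (mem_Icc.1 hi).2
    omega
  have h6 := h3.trans (Nat.mul_le_mul h5 h4)
  rw [hc] at h6
  have h7 : c * L r a ≤ c * (2 * (B ^ D * Y)) := by
    calc _ = L r a * c := mul_comm _ _
      _ ≤ _ := h6
      _ = _ := by ring
  exact absurd (Nat.le_of_mul_le_mul_left h7 hc1) (not_le.2 hL)

/-! ### Colouring and counting coincidences. -/

/-- A positive integer composed of primes below `m`, all of whose prime power parts are at most
`H`, is at most `H ^ z`, where `z` is the number of primes below `m`. -/
theorem le_pow_primeCounting' {x m H : ℕ} (hx : x ≠ 0) (hH : 1 ≤ H)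
    (hs : ∀ p, p.Prime → p ∣ x → p < m) (hp : ∀ p, p.Prime → p < m → p ^ x.factorization p ≤ H) :
    x ≤ H ^ Nat.primeCounting' m := by
  have hsub : x.primeFactors ⊆ m.primesBelow := fun p h => by
    have h1 := Nat.prime_of_mem_primeFactors h
    exact Nat.mem_primesBelow.2 ⟨hs p h1 (Nat.dvd_of_mem_primeFactors h), h1⟩
  calc x = ∏ p ∈ x.primeFactors, p ^ x.factorization p :=
        (Nat.prod_factorization_pow_eq_self hx).symm
    _ ≤ H ^ x.primeFactors.card := prod_le_pow_card _ _ _ fun p h => by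
        have h1 := Nat.prime_of_mem_primeFactors h
        exact hp p h1 (hs p h1 (Nat.dvd_of_mem_primeFactors h))
    _ ≤ H ^ m.primesBelow.card := Nat.pow_le_pow_right hH (card_le_card hsub)
    _ = H ^ Nat.primeCounting' m := by rw [Nat.primesBelow_card_eq_primeCounting']

/-- If `f` is determined by a colouring of `{0, …, W (q + 1) - 1}` with at most `q` colours, then
among the shifts `1 ≤ δ ≤ q` some equation `f (k + δ) = f k` has many solutions. -/
theorem windows_le {α β : Type*} {f : ℕ → α} {c : ℕ → β} {T : Finset β} {q W N : ℕ}
    (hT : T.card ≤ q) (hc : ∀ k < W * (q + 1), c k ∈ T)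
    (hf : ∀ k δ, k + δ < W * (q + 1) → c k = c (k + δ) → f (k + δ) = f k)
    (hN : ∀ δ, 1 ≤ δ → δ ≤ q → ∀ s : Finset ℕ, (∀ k ∈ s, f (k + δ) = f k) → s.card ≤ N) :
    W ≤ q * N := by
  classical
  -- Each block of `q + 1` indices repeats a colour; `k / (q + 1) = w` keeps the chosen `k`
  -- distinct.
  have hw : ∀ w : ℕ, ∃ k, w < W →
      k / (q + 1) = w ∧ ∃ δ, 1 ≤ δ ∧ δ ≤ q ∧ f (k + δ) = f k := by
    intro w
    by_cases hwW : w < W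
    swap
    · exact ⟨0, fun h => absurd h hwW⟩
    have hlt : ∀ i < q + 1, w * (q + 1) + i < W * (q + 1) := fun i hi => by nlinarith
    obtain ⟨i, hi, j, hj, hij, he⟩ := exists_ne_map_eq_of_card_lt_of_maps_to
      (s := range (q + 1)) (t := T) (f := fun i => c (w * (q + 1) + i))
      (by rw [card_range]; omega) (fun i hi => hc _ (hlt i (by simpa using hi)))
    have key : ∀ i j : ℕ, i < j → j < q + 1 → c (w * (q + 1) + i) = c (w * (q + 1) + j) →
        ∃ k, w < W → k / (q + 1) = w ∧ ∃ δ, 1 ≤ δ ∧ δ ≤ q ∧ f (k + δ) = f k := by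
      intro i j hij hj he
      refine ⟨w * (q + 1) + i, fun _ => ⟨?_, j - i, by omega, by omega, ?_⟩⟩
      · rw [mul_comm, Nat.mul_add_div (by omega), Nat.div_eq_of_lt (by omega), add_zero]
      · have e : w * (q + 1) + i + (j - i) = w * (q + 1) + j := by omega
        refine hf _ _ ?_ ?_
        · rw [e]; exact hlt j hj
        · rw [e]; exact he
    rcases lt_or_gt_of_ne hij with h | h
    · exact key i j h (by simpa using hj) he
    · exact key j i h (by simpa using hi) he.symm
  choose κ hκ using hw
  have hinj : Set.InjOn κ (range W : Set ℕ) := fun v hv w hw h => by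
    rw [← (hκ v (by simpa using hv)).1, ← (hκ w (by simpa using hw)).1, h]
  rw [← card_range W, ← card_image_of_injOn hinj]
  have hsub : (range W).image κ ⊆
      (Icc 1 q).biUnion fun δ => ((range W).image κ).filter fun k => f (k + δ) = f k := by
    intro k hk
    obtain ⟨w, hw, rfl⟩ := mem_image.1 hk
    obtain ⟨_, δ, h1, h2, h3⟩ := hκ w (by simpa using hw)
    exact mem_biUnion.2 ⟨δ, mem_Icc.2 ⟨h1, h2⟩, mem_filter.2 ⟨hk, h3⟩⟩
  refine (card_le_card hsub).trans ((card_biUnion_le_card_mul _ _ N fun δ hδ => ?_).trans_eq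
    (by simp))
  exact hN δ (mem_Icc.1 hδ).1 (mem_Icc.1 hδ).2 _ fun k hk => (mem_filter.1 hk).2

/-- Partial sums at a fixed distance `δ t` agree at fewer than `δ t` places of a residue class. -/
theorem card_partialSum_eq_lt {r : ℕ → ℤ} {t : ℕ} (ht : 1 ≤ t)
    (hper : ∀ i : ℕ, 1 ≤ i → r (i + t) = r i) (hne : ∃ i : ℕ, 1 ≤ i ∧ r i ≠ 0) {a δ : ℕ}
    (ha : 1 ≤ a) (hδ : 1 ≤ δ) (s : Finset ℕ)
    (hs : ∀ k ∈ s, partialSum r (a + (k + δ) * t) = partialSum r (a + k * t)) :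
    s.card ≤ δ * t - 1 := by
  obtain ⟨j, h1, h2, h3⟩ := exists_ne_zero_window ht hper hne a
  have hD : t ≤ δ * t := Nat.le_mul_of_pos_left t hδ
  have hP : numerator (fun j => r (a + j)) (δ * t) ≠ 0 :=
    numerator_ne_zero (mem_Icc.2 ⟨h1, by omega⟩) h3
  refine le_trans ?_ (natDegree_numerator_le (fun j => r (a + j)) (δ * t))
  have hinj : Function.Injective fun k : ℕ => ((a + k * t : ℕ) : ℤ) := fun k l h => by
    have h' : a + k * t = a + l * t := Int.natCast_inj.1 h
    exact Nat.eq_of_mul_eq_mul_right ht (by omega)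
  rw [← card_image_of_injective s hinj]
  refine Polynomial.card_le_degree_of_subset_roots fun x hx => ?_
  obtain ⟨k, hk, rfl⟩ := mem_image.1 hx
  rw [Polynomial.mem_roots hP, Polynomial.IsRoot]
  -- Periodicity makes the numerator polynomial independent of `k`.
  have e : (fun j => r (a + j)) = fun j => r (a + k * t + j) := funext fun j => by
    rw [show a + k * t + j = a + j + k * t by ring, apply_add_mul hper (by omega)]
  rw [e, eval_numerator_eq_zero_iff, ← hs k hk]
  congr 1
  ring

/-! ### Numerical estimates. -/

theorem pow_four_le {j : ℕ} (hj : 12 ≤ j) : 2 * (j + 2) ^ 4 ≤ 5 * 5 * 2 ^ j := by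
  induction j, hj using Nat.le_induction with
  | base => norm_num
  | succ j hj ih =>
    have : (j + 1 + 2) ^ 4 ≤ 2 * (j + 2) ^ 4 := by
      obtain ⟨i, rfl⟩ := Nat.exists_eq_add_of_le hj
      ring_nf
      nlinarith [sq_nonneg i, Nat.zero_le (i ^ 3), Nat.zero_le (i ^ 4)]
    rw [pow_succ 2]
    omega

/-- The logarithm of `a` is small compared to `a`. -/
theorem log_mul_pow_le {a m : ℕ} (hm : 2 ≤ m) (ha : 5 * m ^ 10 ≤ a) :
    2 * (Nat.log 2 a + 2) * m ^ 7 ≤ a := by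
  set j := Nat.log 2 a with hj
  have hm10 : 2 ^ 10 ≤ m ^ 10 := Nat.pow_le_pow_left hm 10
  have h2j : 2 ^ j ≤ a := Nat.pow_log_le_self 2 (by omega)
  have hj12 : 12 ≤ j := Nat.le_log_of_pow_le (by norm_num) (by omega)
  by_contra! h
  have h1 : 5 * m ^ 3 < 2 * (j + 2) := by
    have : 5 * m ^ 3 * m ^ 7 < 2 * (j + 2) * m ^ 7 := by
      calc _ = 5 * m ^ 10 := by ring
        _ ≤ a := ha
        _ < _ := h
    exact lt_of_mul_lt_mul_right this (Nat.zero_le _)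
  have h2 : (5 * m ^ 3) ^ 3 ≤ (2 * (j + 2)) ^ 3 := Nat.pow_le_pow_left h1.le 3
  have h3 : 4 * m ^ 7 ≤ m ^ 9 := by
    have : 2 ^ 2 ≤ m ^ 2 := Nat.pow_le_pow_left hm 2
    calc 4 * m ^ 7 ≤ m ^ 2 * m ^ 7 := Nat.mul_le_mul_right _ this
      _ = m ^ 9 := by ring
  have h4 : 125 * (4 * m ^ 7) ≤ 8 * (j + 2) ^ 3 := by
    have e1 : (5 * m ^ 3) ^ 3 = 125 * m ^ 9 := by ring
    have e2 : (2 * (j + 2)) ^ 3 = 8 * (j + 2) ^ 3 := by ring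
    omega
  have h5 := pow_four_le hj12
  have h6 : 125 * 4 * (2 * (j + 2) * m ^ 7) ≤ 16 * (j + 2) ^ 4 := by
    calc _ = 2 * (j + 2) * (125 * (4 * m ^ 7)) := by ring
      _ ≤ 2 * (j + 2) * (8 * (j + 2) ^ 3) := Nat.mul_le_mul_left _ h4
      _ = _ := by ring
  omega

theorem pow_lt_L {r : ℕ → ℤ} {t : ℕ} (ht : 1 ≤ t)
    (hper : ∀ i : ℕ, 1 ≤ i → r (i + t) = r i) (hne : ∃ i : ℕ, 1 ≤ i ∧ r i ≠ 0) {m a : ℕ}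
    (htm : t < m) (ha : 5 * m ^ 10 ≤ a) :
    2 * (2 * a) ^ (m ^ 5 * (m - 1)) < L r a := by
  set j := Nat.log 2 a
  have hlog := log_mul_pow_le (by omega) ha
  have hs : 1 ≤ m ^ 5 * (m - 1) := Nat.mul_pos (pow_pos (by omega) _) (by omega)
  -- Since `2 * a ≤ 2 ^ (j + 2)`, the left side is at most `2 ^ (s + 1) < 4 ^ s`.
  set s := (j + 2) * (m ^ 5 * (m - 1)) with hsdef
  have hs2 : 2 ≤ s := by nlinarith
  have haj : 2 * a ≤ 2 ^ (j + 2) := by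
    have := Nat.lt_pow_succ_log_self (b := 2) (by norm_num) a
    rw [pow_succ]
    change a < 2 ^ (j + 1) at this
    omega
  have h1 : 2 * (2 * a) ^ (m ^ 5 * (m - 1)) ≤ 2 ^ (s + 1) := by
    rw [pow_succ' 2, hsdef, pow_mul 2]
    exact Nat.mul_le_mul_left _ (Nat.pow_le_pow_left haj _)
  have h2 : 2 ^ (s + 1) < 4 ^ s := by
    rw [show (4 : ℕ) = 2 ^ 2 by rfl, ← pow_mul]
    exact Nat.pow_lt_pow_right (by norm_num) (by omega)
  refine h1.trans_lt (h2.trans_le (four_pow_le_L ht hper hne (le_trans ?_ hlog)))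
  obtain ⟨u, rfl⟩ : ∃ u, m = u + 1 := ⟨m - 1, by omega⟩
  rw [Nat.add_sub_cancel] at hsdef hs
  have hu : t ≤ u := by omega
  have h3 : 2 * s + 1 ≤ 2 * (j + 2) * ((u + 1) ^ 5 * (u + 1)) := by
    have h4 : 2 * (j + 2) * ((u + 1) ^ 5 * (u + 1)) = 2 * s + 2 * (j + 2) * (u + 1) ^ 5 := by
      rw [hsdef]; ring
    have : 0 < 2 * (j + 2) * (u + 1) ^ 5 := by positivity
    omega
  calc (2 * s + 1) * t ≤ 2 * (j + 2) * ((u + 1) ^ 5 * (u + 1)) * (u + 1) :=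
        Nat.mul_le_mul h3 (by omega)
    _ = _ := by ring

theorem primeCounting'_add_two_le {m : ℕ} (hm : 2 ≤ m) : Nat.primeCounting' m + 2 ≤ m := by
  have h := Nat.primesBelow_card_eq_primeCounting' m
  have hsub : m.primesBelow ⊆ Ico 2 m := fun p hp => by
    have := Nat.mem_primesBelow.1 hp
    exact mem_Ico.2 ⟨this.2.two_le, this.1⟩
  have := card_le_card hsub
  rw [h, Nat.card_Ico] at this
  omega

/-! ### The main argument. -/

/-- Every interval of length `m ^ 5` far enough out contains an `n` as desired. -/
theorem exists_prime_dvd_X {r : ℕ → ℤ} {t : ℕ} (ht : 1 ≤ t)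
    (hper : ∀ i : ℕ, 1 ≤ i → r (i + t) = r i) (hne : ∃ i : ℕ, 1 ≤ i ∧ r i ≠ 0) {m a : ℕ}
    (htm : t < m) (hrm : ∀ i, 1 ≤ i → (r i).natAbs ≤ m) (ha : 5 * m ^ 10 ≤ a) :
    ∃ n, a ≤ n ∧ n < a + m ^ 5 ∧ X r n ≠ 0 ∧ ∃ p : ℕ, p.Prime ∧ m ≤ p ∧ (p : ℤ) ∣ X r n := by
  classical
  by_contra! hcon
  set z := Nat.primeCounting' m with hz
  have hzm : z + 2 ≤ m := primeCounting'_add_two_le (by omega)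
  have hm5 : 1 ≤ m ^ 5 := Nat.one_le_pow _ _ (by omega)
  have h6 : m ^ 5 * m ≤ a := by
    refine le_trans ?_ ha
    calc m ^ 5 * m = m ^ 6 := by ring
      _ ≤ m ^ 10 := Nat.pow_le_pow_right (by omega) (by norm_num)
      _ ≤ _ := by omega
  have h5a : m ^ 5 ≤ a := le_trans (Nat.le_mul_of_pos_right _ (by omega)) h6
  set H := (2 * a) ^ m ^ 5 with hH
  have hH1 : 1 ≤ H := Nat.one_le_pow _ _ (by omega)
  -- `none` marks a small `X_n` (possibly zero), `some p` a large power of `p`.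
  have hcol : ∀ n, ∃ o : Option ℕ, a ≤ n → n < a + m ^ 5 → o ∈ insertNone m.primesBelow ∧
      (o = none → (X r n).natAbs ≤ H ^ z) ∧
      ∀ p, o = some p → H < p ^ (X r n).natAbs.factorization p := by
    intro n
    by_cases hn : a ≤ n ∧ n < a + m ^ 5
    swap
    · exact ⟨none, fun h1 h2 => absurd ⟨h1, h2⟩ hn⟩
    by_cases hX : (X r n).natAbs ≤ H ^ z
    · exact ⟨none, fun _ _ => ⟨by simp, fun _ => hX, by simp⟩⟩
    have hX0 : X r n ≠ 0 := fun h => hX (by simp [h])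
    have : ∃ p, p.Prime ∧ p < m ∧ H < p ^ (X r n).natAbs.factorization p := by
      by_contra! h
      refine hX (le_pow_primeCounting' (Int.natAbs_ne_zero.2 hX0) hH1 (fun p hp hd => ?_) h)
      by_contra! hpm
      exact hcon n hn.1 hn.2 hX0 p hp hpm (Int.natCast_dvd.2 hd)
    obtain ⟨p, h1, h2, h3⟩ := this
    refine ⟨some p, fun _ _ => ⟨?_, by simp, fun q hq => ?_⟩⟩
    · exact some_mem_insertNone.2 (Nat.mem_primesBelow.2 ⟨h2, h1⟩)
    · cases hq; exact h3
  choose col hcol using hcol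
  have heq : ∀ n D, a ≤ n → n + D < a + m ^ 5 → col n = col (n + D) →
      partialSum r (n + D) = partialSum r n := by
    intro n D h1 h2 hc
    obtain ⟨-, hn0, hnp⟩ := hcol n h1 (by omega)
    obtain ⟨-, hd0, hdp⟩ := hcol (n + D) (by omega) h2
    cases ho : col n with
    | none =>
      refine partialSum_eq_of_X_le (B := 2 * a) (by omega) (hn0 ho) (hd0 (hc ▸ ho)) ?_
      refine lt_of_le_of_lt ?_ ((pow_lt_L ht hper hne htm ha).trans_le
        (Nat.le_of_dvd (L_pos r n) (L_dvd_L r h1)))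
      rw [hH, ← pow_mul, ← pow_add]
      refine Nat.mul_le_mul_left _ (Nat.pow_le_pow_right (by omega) ?_)
      calc D + m ^ 5 * z ≤ m ^ 5 * (z + 1) := by rw [Nat.mul_succ]; omega
        _ ≤ _ := Nat.mul_le_mul_left _ (by omega)
    | some p =>
      obtain ⟨hp, -, -⟩ := hcol n h1 (by omega)
      rw [ho] at hp
      have hpp : p.Prime := (Nat.mem_primesBelow.1 (some_mem_insertNone.1 hp)).2
      by_contra hne'
      have hlt : H < p ^ min ((X r n).natAbs.factorization p)
          ((X r (n + D)).natAbs.factorization p) := by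
        rcases min_choice ((X r n).natAbs.factorization p)
          ((X r (n + D)).natAbs.factorization p) with h | h
        · rw [h]; exact hnp p ho
        · rw [h]; exact hdp p (hc ▸ ho)
      have hdvd : ∀ {e k : ℕ}, e ≤ (X r k).natAbs.factorization p → (p : ℤ) ^ e ∣ X r k := by
        intro e k h
        have := (pow_dvd_pow p h).trans (Nat.ordProj_dvd _ p)
        exact_mod_cast Int.natCast_dvd.2 this
      have := prime_pow_le_of_dvd_X hpp (by omega) hrm (B := 2 * a) (by omega)
        ((Nat.mul_le_mul_right m (by omega : D ≤ m ^ 5)).trans (by omega)) hne'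
        (hdvd (min_le_left _ _)) (hdvd (min_le_right _ _))
      have h7 : (2 * a) ^ (D + 1) ≤ H := Nat.pow_le_pow_right (by omega) (by omega)
      omega
  set q := z + 1 with hq
  -- The `q * q * t` blocks fit because `q`, `q + 1` and `t` are at most `m`.
  have hk : ∀ k < q * q * t * (q + 1), a + k * t < a + m ^ 5 := by
    intro k hk
    have h8 : k * t < q * q * t * (q + 1) * t := Nat.mul_lt_mul_of_pos_right hk ht
    have h9 : q * q * t * (q + 1) * t ≤ m * m * m * m * m := by
      gcongr <;> omega
    have e : m * m * m * m * m = m ^ 5 := by ring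
    omega
  have hW := windows_le (f := fun k => partialSum r (a + k * t)) (c := fun k => col (a + k * t))
    (T := insertNone m.primesBelow) (q := q) (W := q * q * t) (N := q * t - 1)
    (by rw [card_insertNone, Nat.primesBelow_card_eq_primeCounting'])
    (fun k h => (hcol _ (by omega) (hk k h)).1)
    (fun k δ h hc => by
      have e : a + (k + δ) * t = a + k * t + δ * t := by ring
      have := hk _ h
      simp only [e] at hc this ⊢
      exact heq _ _ (by omega) this hc)
    (fun δ h1 h2 s hs => (card_partialSum_eq_lt ht hper hne (by omega) h1 s hs).trans
      (Nat.sub_le_sub_right (Nat.mul_le_mul_right t h2) 1))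
  -- The count gives `q * q * t ≤ q * (q * t - 1)`, which is absurd.
  have hqt : 0 < q * t := Nat.mul_pos (by omega) ht
  have : q * (q * t - 1) < q * (q * t) := Nat.mul_lt_mul_of_pos_left (by omega) (by omega)
  rw [mul_assoc] at hW
  omega

end PeriodicHarmonic

open PeriodicHarmonic

theorem mainTheorem7 (r : ℕ → ℤ) (t : ℕ) (ht : 1 ≤ t)
    (hper : ∀ i : ℕ, 1 ≤ i → r (i + t) = r i)
    (hne : ∃ i : ℕ, 1 ≤ i ∧ r i ≠ 0) :
    ∃ n ∈ PeriodicHarmonic.I₀ r t, PeriodicHarmonic.X r n ≠ 0 ∧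
      ∃ p : ℕ, p.Prime ∧ PeriodicHarmonic.bound r t ≤ p ∧
        (p : ℤ) ∣ PeriodicHarmonic.X r n := by
  have htm : t < bound r t := Nat.lt_succ_of_le (le_max_right _ _)
  have hrm : ∀ i, 1 ≤ i → (r i).natAbs ≤ bound r t := fun i hi =>
    ((maxAbs_isGreatest r t ht hper).2 ⟨i, hi, rfl⟩).trans
      ((le_max_left _ _).trans (Nat.le_succ _))
  have hcen : 42 * bound r t ^ (3 * numPrimes r t + 7) < center r t :=
    (Nat.sInf_mem (center_nonempty r t ht)).1
  have hlen : bound r t ^ 5 ≤ len r t := Nat.pow_le_pow_right (by omega) (by omega)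
  -- The 41 is 42 less one for the length of `J₁`. If `z = 0` then `m = 2`, and `5 * 2 ^ 10 ≤ 41 * 2
  -- ^ 7`.
  have hbig : 5 * bound r t ^ 10 ≤ 41 * bound r t ^ (3 * numPrimes r t + 7) := by
    rcases Nat.eq_zero_or_pos (numPrimes r t) with h0 | h0
    · have h2 : bound r t = 2 := by
        by_contra hb
        have : 0 < numPrimes r t := by
          rw [numPrimes, ← Nat.primesBelow_card_eq_primeCounting', Finset.card_pos]
          exact ⟨2, Nat.mem_primesBelow.2 ⟨by omega, Nat.prime_two⟩⟩
        omega
      rw [h0, h2]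
      norm_num
    · exact Nat.mul_le_mul (by norm_num) (Nat.pow_le_pow_right (by omega) (by omega))
  have hlen' : len r t ≤ bound r t ^ (3 * numPrimes r t + 7) :=
    Nat.pow_le_pow_right (by omega) (by omega)
  unfold I₀
  split_ifs
  · obtain ⟨n, h1, h2, h3⟩ := exists_prime_dvd_X ht hper hne htm hrm
      (a := center r t - len r t) (by omega)
    exact ⟨n, Finset.mem_Ico.2 ⟨h1, by omega⟩, h3⟩
  · obtain ⟨n, h1, h2, h3⟩ := exists_prime_dvd_X ht hper hne htm hrm
      (a := center r t) (by omega)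
    exact ⟨n, Finset.mem_Ico.2 ⟨h1, by omega⟩, h3⟩
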